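/- Let $\mathbb{D}=\{z\in\mathbb{C} : |z|<1\}$ and let $f:\mathbb{D}\to\mathbb{D}$ be a holomorphic map without fixed points in $\mathbb{D}$. Write $f^n$ for its $n$-th iterate, and let $\tau_f\in\partial\mathbb{D}$ be its Wolff point, that is, the point of the unit circle such that $f^n\to\tau_f$ uniformly on compact subsets of $\mathbb{D}$. Assume that $f$ is parabolic, i.e. that the derivative $f'$ has non-tangential limit $1$ at $\tau_f$: for every $M>1$, $f'(z)\to 1$ as $z\to\tau_f$ within the Stolz region $\{z\in\mathbb{D} : |\tau_f-z|<M(1-|z|)\}$. Then for every $z_0\in\mathbb{D}$, $$\frac{f^n(z)-\tau_f}{f^n(z_0)-\tau_f}\longrightarrow 1\qquad (n\to+\infty)$$ uniformly for $z$ in compact subsets of $\mathbb{D}$. -/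

import Mathlib

open Set Filter Topology Metric

namespace ParabolicDisk

/-- The open unit disk of the complex plane. -/
def disk : Set ℂ := ball (0 : ℂ) 1

/-- `f` restricts to a holomorphic self-map of the unit disk. -/
structure IsHolSelfMap (f : ℂ → ℂ) : Prop where
  differentiableOn : DifferentiableOn ℂ f disk
  mapsTo : MapsTo f disk disk

/-- `F n → g` uniformly on every compact subset of the unit disk. -/
def TendstoOnCompacts (F : ℕ → ℂ → ℂ) (g : ℂ → ℂ) : Prop :=
  ∀ K : Set ℂ, K ⊆ disk → IsCompact K → TendstoUniformlyOn F g atTop K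

/-- The Stolz region of vertex `τ` and amplitude `M`. -/
def stolzRegion (τ : ℂ) (M : ℝ) : Set ℂ := {z | z ∈ disk ∧ ‖τ - z‖ < M * (1 - ‖z‖)}

/-- `g` has non-tangential limit `l` at the boundary point `τ` of the disk:
it tends to `l` along every Stolz region of vertex `τ`. -/
def HasNontangentialLimit (g : ℂ → ℂ) (τ l : ℂ) : Prop :=
  ∀ M : ℝ, 1 < M → Tendsto g (𝓝[stolzRegion τ M] τ) (𝓝 l)

/-- `τ` is the Wolff point of the self-map `f`: `f` has no fixed points in the disk, `τ` lies on
the unit circle, and the iterates of `f` converge to `τ` uniformly on compact subsets. -/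
structure IsWolffPoint (f : ℂ → ℂ) (τ : ℂ) : Prop where
  no_fixedPoint : ∀ z ∈ disk, f z ≠ z
  mem_sphere : τ ∈ sphere (0 : ℂ) 1
  tendsto_iterate : TendstoOnCompacts (fun n => f^[n]) (fun _ => τ)

/-- `f` is a parabolic self-map of the disk with Wolff point `τ`: a holomorphic self-map without
fixed points whose derivative has non-tangential limit `1` at its Wolff point `τ`. -/
structure IsParabolic (f : ℂ → ℂ) (τ : ℂ) : Prop where
  isHolSelfMap : IsHolSelfMap f
  isWolffPoint : IsWolffPoint f τ
  deriv_eq_one : HasNontangentialLimit (deriv f) τ 1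

end ParabolicDisk

namespace ParabolicDisk

open scoped ComplexConjugate

/-! Write z_n = f^n(z₀). The ratio at z differs from 1 by at most a factor controlled by `pdist
(f^[n] z) (f^[n] z₀)` times 2(1 - |z_n|)/|z_n - τ| (`norm_div_sub_one_le`). If the orbit is
tangential, the second factor tends to 0, while Schwarz–Pick keeps the first bounded on compacts.
Otherwise the orbit visits some Stolz region infinitely often. There f' → 1 makes f(z) - z Lipschitz
with a small constant, which forces the hyperbolic steps of the orbit to 0
(`tendsto_step_of_frequently_stolz`). A three-point Schwarz–Pick inequality and connectedness then
bring all orbits together (`tendsto_pdist_iterate`), so the first factor tends to 0. -/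

/-! ### Möbius maps and the pseudo-hyperbolic distance. -/

/-- The automorphism of the unit disk that sends `b` to `0`. -/
noncomputable def moebius (b z : ℂ) : ℂ := (z - b) / (1 - conj b * z)

/-- The pseudo-hyperbolic distance of the unit disk. -/
noncomputable def pdist (z w : ℂ) : ℝ := ‖moebius w z‖

lemma mem_disk {z : ℂ} : z ∈ disk ↔ ‖z‖ < 1 := by simp [disk]

lemma zero_mem_disk : (0 : ℂ) ∈ disk := by simp [disk]

lemma pdist_nonneg (z w : ℂ) : 0 ≤ pdist z w := norm_nonneg _

lemma sq_norm_one_sub_conj_mul (b z : ℂ) :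
    ‖1 - conj b * z‖ ^ 2 = ‖z - b‖ ^ 2 + (1 - ‖z‖ ^ 2) * (1 - ‖b‖ ^ 2) := by
  simp only [← Complex.normSq_eq_norm_sq, Complex.normSq_apply]
  simp
  ring

lemma one_sub_conj_mul_ne_zero {b z : ℂ} (hb : b ∈ disk) (hz : z ∈ disk) :
    1 - conj b * z ≠ 0 := by
  rw [mem_disk] at hb hz
  intro h
  have h1 : conj b * z = 1 := (sub_eq_zero.mp h).symm
  have h2 : ‖b‖ * ‖z‖ = 1 := by simpa using congrArg norm h1
  nlinarith [norm_nonneg b, norm_nonneg z]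

lemma moebius_mem_disk {b z : ℂ} (hb : b ∈ disk) (hz : z ∈ disk) : moebius b z ∈ disk := by
  have h0 := norm_pos_iff.mpr (one_sub_conj_mul_ne_zero hb hz)
  have h1 := sq_norm_one_sub_conj_mul b z
  rw [mem_disk] at *
  rw [moebius, norm_div, div_lt_one h0]
  refine lt_of_pow_lt_pow_left₀ 2 h0.le ?_
  rw [h1]
  have : 0 < (1 - ‖z‖ ^ 2) * (1 - ‖b‖ ^ 2) := by
    apply mul_pos <;> nlinarith [norm_nonneg b, norm_nonneg z]
  linarith

lemma pdist_lt_one {z w : ℂ} (hz : z ∈ disk) (hw : w ∈ disk) : pdist z w < 1 :=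
  mem_disk.mp (moebius_mem_disk hw hz)

lemma differentiableOn_moebius {b : ℂ} (hb : b ∈ disk) : DifferentiableOn ℂ (moebius b) disk := by
  intro z hz
  have := one_sub_conj_mul_ne_zero hb hz
  unfold moebius
  fun_prop (disch := assumption)

lemma isHolSelfMap_moebius {b : ℂ} (hb : b ∈ disk) : IsHolSelfMap (moebius b) :=
  ⟨differentiableOn_moebius hb, fun _ hz => moebius_mem_disk hb hz⟩

lemma neg_mem_disk {b : ℂ} (hb : b ∈ disk) : -b ∈ disk := by simpa [mem_disk] using hb

@[simp] lemma moebius_self (b : ℂ) : moebius b b = 0 := by simp [moebius]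

@[simp] lemma moebius_neg_zero (b : ℂ) : moebius (-b) 0 = b := by simp [moebius]

lemma moebius_neg_moebius {b z : ℂ} (hb : b ∈ disk) (hz : z ∈ disk) :
    moebius (-b) (moebius b z) = z := by
  have h1 := one_sub_conj_mul_ne_zero hb hz
  have h2 : 1 - conj b * b ≠ 0 := one_sub_conj_mul_ne_zero hb hb
  have h3 : moebius b z + b = z * (1 - conj b * b) / (1 - conj b * z) := by
    rw [moebius, eq_div_iff h1, add_mul, div_mul_cancel₀ _ h1]; ring
  have h4 : 1 + conj b * moebius b z = (1 - conj b * b) / (1 - conj b * z) := by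
    rw [moebius, eq_div_iff h1, add_mul, mul_assoc, div_mul_cancel₀ _ h1]; ring
  have h5 : moebius (-b) (moebius b z)
      = (moebius b z + b) / (1 + conj b * moebius b z) := by
    simp [moebius]
  rw [h5, h3, h4, div_div_div_cancel_right₀ h1, mul_div_cancel_right₀ _ h2]

lemma pdist_eq_zero {z w : ℂ} (hz : z ∈ disk) (hw : w ∈ disk) : pdist z w = 0 ↔ z = w := by
  simp [pdist, moebius, one_sub_conj_mul_ne_zero hw hz, sub_eq_zero]

@[simp] lemma pdist_self (z : ℂ) : pdist z z = 0 := by simp [pdist]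

lemma pdist_comm (z w : ℂ) : pdist z w = pdist w z := by
  have : ‖1 - conj w * z‖ = ‖1 - conj z * w‖ := by
    rw [← Complex.norm_conj]; simp [mul_comm]
  rw [pdist, pdist, moebius, moebius, norm_div, norm_div, norm_sub_rev, this]

lemma continuousOn_pdist {w : ℂ} (hw : w ∈ disk) : ContinuousOn (fun z => pdist z w) disk :=
  (differentiableOn_moebius hw).continuousOn.norm

lemma IsHolSelfMap.comp {f g : ℂ → ℂ} (hf : IsHolSelfMap f) (hg : IsHolSelfMap g) :
    IsHolSelfMap (f ∘ g) :=
  ⟨hf.differentiableOn.comp hg.differentiableOn hg.mapsTo, hf.mapsTo.comp hg.mapsTo⟩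

lemma IsHolSelfMap.iterate {f : ℂ → ℂ} (hf : IsHolSelfMap f) (n : ℕ) : IsHolSelfMap f^[n] := by
  induction n with
  | zero => exact ⟨differentiableOn_id, fun _ h => h⟩
  | succ n ih => rw [Function.iterate_succ]; exact ih.comp hf

/-! ### Schwarz–Pick inequalities. -/

/-- A self-map of the disk conjugated so as to fix the origin. -/
lemma IsHolSelfMap.exists_conj {g : ℂ → ℂ} (hg : IsHolSelfMap g) {w : ℂ} (hw : w ∈ disk) :
    ∃ φ : ℂ → ℂ, IsHolSelfMap φ ∧ φ 0 = 0 ∧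
      ∀ z ∈ disk, φ (moebius w z) = moebius (g w) (g z) := by
  refine ⟨moebius (g w) ∘ g ∘ moebius (-w), ?_, by simp, fun z hz => ?_⟩
  · exact (isHolSelfMap_moebius (hg.mapsTo hw)).comp
      (hg.comp (isHolSelfMap_moebius (neg_mem_disk hw)))
  · simp [moebius_neg_moebius hw hz]

lemma IsHolSelfMap.norm_dslope_le_one {φ : ℂ → ℂ} (hφ : IsHolSelfMap φ) (h0 : φ 0 = 0) {c : ℂ}
    (hc : c ∈ disk) : ‖dslope φ 0 c‖ ≤ 1 := by
  have := Complex.norm_dslope_le_div_of_mapsTo_ball (R₂ := 1) hφ.differentiableOn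
    (by rw [h0]; exact hφ.mapsTo.mono_right ball_subset_closedBall) hc
  simpa using this

lemma norm_eq_mul_norm_dslope {φ : ℂ → ℂ} (h0 : φ 0 = 0) (c : ℂ) :
    ‖φ c‖ = ‖c‖ * ‖dslope φ 0 c‖ := by
  have := sub_smul_dslope φ 0 c
  rw [← norm_mul, ← smul_eq_mul]
  simpa [h0] using (congrArg norm this).symm

/-- The slope φ(c)/c is bounded by 1, so it stays within 2 of its value at 0; the Schwarz lemma
applies to it. -/
lemma IsHolSelfMap.dist_dslope_le {φ : ℂ → ℂ} (hφ : IsHolSelfMap φ) (h0 : φ 0 = 0) {c : ℂ}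
    (hc : c ∈ disk) : ‖dslope φ 0 c - dslope φ 0 0‖ ≤ 2 * ‖c‖ := by
  have hd : DifferentiableOn ℂ (dslope φ 0) disk :=
    (Complex.differentiableOn_dslope (isOpen_ball.mem_nhds zero_mem_disk)).mpr hφ.differentiableOn
  have := Complex.dist_le_div_mul_dist_of_mapsTo_ball (R₂ := 2) hd (fun z hz => by
    rw [mem_closedBall, dist_eq_norm]
    have h1 := hφ.norm_dslope_le_one h0 hz
    have h2 := hφ.norm_dslope_le_one h0 zero_mem_disk
    linarith [norm_sub_le (dslope φ 0 z) (dslope φ 0 0)]) hc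
  simpa [dist_eq_norm] using this

/-- The **Schwarz–Pick lemma**. -/
lemma IsHolSelfMap.pdist_le {g : ℂ → ℂ} (hg : IsHolSelfMap g) {z w : ℂ} (hz : z ∈ disk)
    (hw : w ∈ disk) : pdist (g z) (g w) ≤ pdist z w := by
  obtain ⟨φ, hφ, h0, hφg⟩ := hg.exists_conj hw
  have hc := moebius_mem_disk hw hz
  rw [pdist, ← hφg z hz, norm_eq_mul_norm_dslope h0]
  exact mul_le_of_le_one_right (norm_nonneg _) (hφ.norm_dslope_le_one h0 hc)

/-- A three-point version of the Schwarz–Pick lemma. -/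
lemma IsHolSelfMap.pdist_mul_le {g : ℂ → ℂ} (hg : IsHolSelfMap g) {u v w : ℂ} (hu : u ∈ disk)
    (hv : v ∈ disk) (hw : w ∈ disk) :
    pdist (g u) (g w) * pdist v w ≤
      pdist u w * (pdist (g v) (g w) + 2 * pdist v w * (pdist v w + pdist u w)) := by
  obtain ⟨φ, hφ, h0, hφg⟩ := hg.exists_conj hw
  have hc := moebius_mem_disk hw hu
  have ha := moebius_mem_disk hw hv
  simp only [pdist]
  rw [← hφg u hu, ← hφg v hv, norm_eq_mul_norm_dslope h0 (moebius w u),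
    norm_eq_mul_norm_dslope h0 (moebius w v)]
  have h1 := hφ.dist_dslope_le h0 hc
  have h2 := hφ.dist_dslope_le h0 ha
  set c := moebius w u
  set a := moebius w v
  -- Both slopes are compared with the slope at 0, the image of w.
  have h3 : ‖dslope φ 0 c‖ ≤ ‖dslope φ 0 a‖ + 2 * (‖a‖ + ‖c‖) := by
    have e : dslope φ 0 c = dslope φ 0 a + (dslope φ 0 c - dslope φ 0 0)
        - (dslope φ 0 a - dslope φ 0 0) := by ring
    calc ‖dslope φ 0 c‖ ≤ ‖dslope φ 0 a‖ + ‖dslope φ 0 c - dslope φ 0 0‖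
          + ‖dslope φ 0 a - dslope φ 0 0‖ := by
          conv_lhs => rw [e]
          exact (norm_sub_le _ _).trans (by gcongr; exact norm_add_le _ _)
      _ ≤ _ := by linarith
  calc ‖c‖ * ‖dslope φ 0 c‖ * ‖a‖
      ≤ ‖c‖ * (‖dslope φ 0 a‖ + 2 * (‖a‖ + ‖c‖)) * ‖a‖ := by gcongr
    _ = _ := by ring

/-! ### Triangle inequality and comparison with Euclidean distance. -/

lemma pdist_le_add_norm {a c : ℂ} (ha : a ∈ disk) (hc : c ∈ disk) : pdist a c ≤ ‖a‖ + ‖c‖ := by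
  have h0 := norm_pos_iff.mpr (one_sub_conj_mul_ne_zero hc ha)
  have h1 := sq_norm_one_sub_conj_mul c a
  rw [mem_disk] at ha hc
  rw [pdist, moebius, norm_div, div_le_iff₀ h0]
  refine le_of_sq_le_sq ?_ (by positivity)
  rw [mul_pow, h1]
  have h2 : ‖a - c‖ ^ 2 ≤ (‖a‖ + ‖c‖) ^ 2 := by gcongr; exact norm_sub_le _ _
  have ha0 := norm_nonneg a
  have hc0 := norm_nonneg c
  set s := ‖a‖
  set t := ‖c‖
  set D := ‖a - c‖ ^ 2
  have hD : 0 ≤ D := by positivity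
  by_cases hst : 1 ≤ s + t
  · have : 0 ≤ (1 - s ^ 2) * (1 - t ^ 2) := by
      apply mul_nonneg <;> nlinarith
    have h4 : 1 ≤ (s + t) ^ 2 := by nlinarith
    nlinarith [mul_nonneg (sub_nonneg.mpr h4) hD, sq_nonneg (s + t)]
  · push Not at hst
    have h5 : 0 ≤ 1 - (s + t) ^ 2 := by nlinarith
    have h6 : (1 - (s + t) ^ 2) * D ≤ (1 - (s + t) ^ 2) * (s + t) ^ 2 := by gcongr
    have h7 : (1 - (s + t) ^ 2) ≤ (1 - s ^ 2) * (1 - t ^ 2) := by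
      nlinarith [mul_nonneg ha0 hc0, mul_nonneg (mul_nonneg ha0 hc0) (mul_nonneg ha0 hc0)]
    have h8 : (s + t) ^ 2 * (1 - (s + t) ^ 2) ≤ (s + t) ^ 2 * ((1 - s ^ 2) * (1 - t ^ 2)) := by
      gcongr
    nlinarith

/-- Moving b to 0 reduces this to `pdist_le_add_norm`; Schwarz–Pick for the inverse automorphism
carries the bound back. -/
lemma pdist_triangle {a b c : ℂ} (ha : a ∈ disk) (hb : b ∈ disk) (hc : c ∈ disk) :
    pdist a c ≤ pdist a b + pdist b c := by
  have h := (isHolSelfMap_moebius (neg_mem_disk hb)).pdist_le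
    (moebius_mem_disk hb ha) (moebius_mem_disk hb hc)
  rw [moebius_neg_moebius hb ha, moebius_neg_moebius hb hc] at h
  rw [pdist_comm b c]
  exact h.trans (pdist_le_add_norm (moebius_mem_disk hb ha) (moebius_mem_disk hb hc))

/-- Since 1 - z̄u = (1 - |z|²) - z̄(u - z), one gets |u - z| ≤ p(1 - |z|² + |u - z|), which is
solved for |u - z|. -/
lemma norm_sub_le_of_pdist {u z : ℂ} (hu : u ∈ disk) (hz : z ∈ disk) :
    ‖u - z‖ ≤ pdist u z / (1 - pdist u z) * (1 - ‖z‖ ^ 2) := by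
  have h0 := norm_pos_iff.mpr (one_sub_conj_mul_ne_zero hz hu)
  have hp : ‖u - z‖ = pdist u z * ‖1 - conj z * u‖ := by
    rw [pdist, moebius, norm_div, div_mul_cancel₀ _ h0.ne']
  have hp1 := pdist_lt_one hu hz
  have hp0 := pdist_nonneg u z
  rw [mem_disk] at hz
  have h1 : ‖1 - conj z * u‖ ≤ (1 - ‖z‖ ^ 2) + ‖u - z‖ := by
    have e : 1 - conj z * u = ((1 - ‖z‖ ^ 2 : ℝ) : ℂ) - conj z * (u - z) := by
      have := Complex.conj_mul' z
      push_cast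
      rw [← this]; ring
    have h2 : 0 ≤ 1 - ‖z‖ ^ 2 := by nlinarith [norm_nonneg z]
    calc ‖1 - conj z * u‖ ≤ ‖((1 - ‖z‖ ^ 2 : ℝ) : ℂ)‖ + ‖conj z * (u - z)‖ := by
          rw [e]; exact norm_sub_le _ _
      _ ≤ _ := by
          rw [Complex.norm_real, Real.norm_of_nonneg h2, norm_mul, Complex.norm_conj]
          gcongr
          exact mul_le_of_le_one_left (norm_nonneg _) hz.le
  rw [div_mul_eq_mul_div, le_div_iff₀ (by linarith)]
  nlinarith [mul_le_mul_of_nonneg_left h1 hp0]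

lemma pdist_le_of_norm_sub_le {u z : ℂ} (hu : u ∈ disk) (hz : z ∈ disk) {C : ℝ}
    (h : ‖u - z‖ ≤ C * (1 - ‖z‖)) : pdist u z ≤ C := by
  have h0 := norm_pos_iff.mpr (one_sub_conj_mul_ne_zero hz hu)
  rw [mem_disk] at hu hz
  have hC : 0 ≤ C := by nlinarith [norm_nonneg (u - z)]
  have h1 : 1 - ‖z‖ ≤ ‖1 - conj z * u‖ := by
    have := norm_sub_norm_le (1 : ℂ) (conj z * u)
    rw [norm_mul, Complex.norm_conj, norm_one] at this
    nlinarith [norm_nonneg z]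
  rw [pdist, moebius, norm_div, div_le_iff₀ h0]
  exact h.trans (by gcongr)

/-! ### Hyperbolic distances along orbits. -/

section Dynamics

variable {f : ℂ → ℂ}

lemma IsHolSelfMap.antitone_pdist_iterate (hf : IsHolSelfMap f) {z w : ℂ} (hz : z ∈ disk)
    (hw : w ∈ disk) : Antitone fun n => pdist (f^[n] z) (f^[n] w) := by
  refine antitone_nat_of_succ_le fun n => ?_
  rw [Function.iterate_succ_apply', Function.iterate_succ_apply']
  exact hf.pdist_le ((hf.iterate n).mapsTo hz) ((hf.iterate n).mapsTo hw)

/-- The distances decrease to some ρ < 1/2. The three-point inequality for a tail of the iteration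
gives ρ ≤ 2ρ², hence ρ = 0. -/
lemma tendsto_pdist_iterate_of_lt_half (hf : IsHolSelfMap f) (hfix : ∀ z ∈ disk, f z ≠ z)
    {z w : ℂ} (hz : z ∈ disk) (hw : w ∈ disk)
    (hstep : Tendsto (fun n => pdist (f^[n] (f z)) (f^[n] z)) atTop (𝓝 0))
    (hwz : pdist w z < 1 / 2) :
    Tendsto (fun n => pdist (f^[n] w) (f^[n] z)) atTop (𝓝 0) := by
  have hanti := hf.antitone_pdist_iterate hw hz
  have hbdd : BddBelow (range fun n => pdist (f^[n] w) (f^[n] z)) :=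
    ⟨0, by rintro _ ⟨n, rfl⟩; exact pdist_nonneg _ _⟩
  have hlim := tendsto_atTop_ciInf hanti hbdd
  set ρ := ⨅ n, pdist (f^[n] w) (f^[n] z)
  have hρ0 : 0 ≤ ρ := ge_of_tendsto' hlim fun n => pdist_nonneg _ _
  have hρ1 : ρ ≤ pdist w z := by simpa using hanti.le_of_tendsto hlim 0
  have key : ∀ m, ρ ≤ 2 * pdist (f^[m] w) (f^[m] z) *
      (pdist (f^[m] (f z)) (f^[m] z) + pdist (f^[m] w) (f^[m] z)) := by
    intro m
    have hzm := (hf.iterate m).mapsTo hz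
    have hwm := (hf.iterate m).mapsTo hw
    have hfz := (hf.iterate m).mapsTo (hf.mapsTo hz)
    -- The absence of fixed points permits division by the step.
    have hpos : 0 < pdist (f^[m] (f z)) (f^[m] z) := by
      refine lt_of_le_of_ne (pdist_nonneg _ _) fun h => ?_
      have := (pdist_eq_zero hfz hzm).mp h.symm
      rw [← Function.iterate_succ_apply, Function.iterate_succ_apply'] at this
      exact hfix _ hzm this
    have h1 : ∀ n, pdist (f^[n + m] w) (f^[n + m] z) * pdist (f^[m] (f z)) (f^[m] z) ≤
        pdist (f^[m] w) (f^[m] z) * (pdist (f^[n + m] (f z)) (f^[n + m] z) +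
          2 * pdist (f^[m] (f z)) (f^[m] z) *
            (pdist (f^[m] (f z)) (f^[m] z) + pdist (f^[m] w) (f^[m] z))) := by
      intro n
      simpa only [Function.iterate_add_apply] using (hf.iterate n).pdist_mul_le hwm hfz hzm
    have h2 := le_of_tendsto_of_tendsto'
      (((tendsto_add_atTop_iff_nat m).mpr hlim).mul_const _)
      ((((tendsto_add_atTop_iff_nat m).mpr hstep).add_const _).const_mul _) h1
    refine le_of_mul_le_mul_right (h2.trans_eq ?_) hpos
    ring
  have h3 : ρ ≤ 2 * ρ * (0 + ρ) :=
    ge_of_tendsto' ((hlim.const_mul 2).mul (hstep.add hlim)) key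
  have : ρ = 0 := by nlinarith
  rwa [this] at hlim

/-- The radius 1/2 does not depend on the centre, so the set of points whose orbits approach that of
z₀ is open and closed in the connected disk. -/
lemma tendsto_pdist_iterate (hf : IsHolSelfMap f) (hfix : ∀ z ∈ disk, f z ≠ z)
    {z₀ : ℂ} (hz₀ : z₀ ∈ disk)
    (hstep : Tendsto (fun n => pdist (f^[n] (f z₀)) (f^[n] z₀)) atTop (𝓝 0))
    {z : ℂ} (hz : z ∈ disk) :
    Tendsto (fun n => pdist (f^[n] z) (f^[n] z₀)) atTop (𝓝 0) := by
  have hopen : IsOpen disk := isOpen_ball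
  set A : Set ℂ := {z | z ∈ disk ∧ Tendsto (fun n => pdist (f^[n] z) (f^[n] z₀)) atTop (𝓝 0)}
  have hnear : ∀ a ∈ disk, ∀ᶠ x in 𝓝 a, x ∈ disk ∧ pdist x a < 1 / 2 := fun a ha => by
    refine (hopen.eventually_mem ha).and ?_
    refine ((continuousOn_pdist ha).continuousAt (hopen.mem_nhds ha)).eventually_lt_const ?_
    simp
  have htrans : ∀ {x y : ℂ}, x ∈ disk → y ∈ disk →
      Tendsto (fun n => pdist (f^[n] x) (f^[n] y)) atTop (𝓝 0) → y ∈ A → x ∈ A := by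
    intro x y hx hy h1 h2
    refine ⟨hx, squeeze_zero (fun _ => pdist_nonneg _ _) (fun n => ?_)
      (by simpa using h1.add h2.2)⟩
    exact pdist_triangle ((hf.iterate n).mapsTo hx) ((hf.iterate n).mapsTo hy)
      ((hf.iterate n).mapsTo hz₀)
  have hball : ∀ a ∈ A, ∀ x ∈ disk, pdist x a < 1 / 2 → x ∈ A := by
    intro a ha x hx hxa
    refine htrans hx ha.1 (tendsto_pdist_iterate_of_lt_half hf hfix ha.1 hx ?_ hxa) ha
    have hfa := hf.mapsTo ha.1
    have h1 : Tendsto (fun n => pdist (f^[n] (f a)) (f^[n] (f z₀))) atTop (𝓝 0) := by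
      have := (tendsto_add_atTop_iff_nat 1).mpr ha.2
      simpa only [Function.iterate_add_apply, Function.iterate_one] using this
    refine squeeze_zero (fun _ => pdist_nonneg _ _) (fun n => ?_)
      (by simpa using (h1.add hstep).add ha.2)
    have m1 := (hf.iterate n).mapsTo hfa
    have m2 := (hf.iterate n).mapsTo (hf.mapsTo hz₀)
    have m3 := (hf.iterate n).mapsTo hz₀
    have m4 := (hf.iterate n).mapsTo ha.1
    have t1 := pdist_triangle m1 m3 m4
    have t2 := pdist_triangle m1 m2 m3
    rw [pdist_comm (f^[n] z₀)] at t1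
    linarith
  have hAo : IsOpen A := isOpen_iff_mem_nhds.mpr fun a ha => by
    filter_upwards [hnear a ha.1] with x hx using hball a ha x hx.1 hx.2
  have hsub : disk ⊆ A := by
    refine (convex_ball (0 : ℂ) 1).isPreconnected.subset_of_closure_inter_subset hAo
      ⟨z₀, hz₀, hz₀, by simp⟩ ?_
    rintro x ⟨hxA, hx⟩
    obtain ⟨y, hy, hyA⟩ := mem_closure_iff_nhds.mp hxA _ (hnear x hx)
    exact hball y hyA x hx (by rw [pdist_comm]; exact hy.2)
  exact (hsub hz).2

/-- Dini's theorem: the distances decrease in n. -/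
lemma tendstoUniformlyOn_pdist_iterate (hf : IsHolSelfMap f) (hfix : ∀ z ∈ disk, f z ≠ z)
    {z₀ : ℂ} (hz₀ : z₀ ∈ disk)
    (hstep : Tendsto (fun n => pdist (f^[n] (f z₀)) (f^[n] z₀)) atTop (𝓝 0))
    {K : Set ℂ} (hK : K ⊆ disk) (hKc : IsCompact K) :
    TendstoUniformlyOn (fun n z => pdist (f^[n] z) (f^[n] z₀)) (fun _ => 0) atTop K := by
  refine Antitone.tendstoUniformlyOn_of_forall_tendsto hKc (fun n => ?_)
    (fun z hz => hf.antitone_pdist_iterate (hK hz) hz₀) continuousOn_const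
    fun z hz => tendsto_pdist_iterate hf hfix hz₀ hstep (hK hz)
  exact ((continuousOn_pdist ((hf.iterate n).mapsTo hz₀)).comp
    (hf.iterate n).differentiableOn.continuousOn (hf.iterate n).mapsTo).mono hK

/-- Convexity is what the mean value inequality for f(z) - z needs. -/
lemma convex_stolzRegion (τ : ℂ) {M : ℝ} (hM : 0 < M) : Convex ℝ (stolzRegion τ M) := by
  have h1 : ConvexOn ℝ (univ : Set ℂ) fun z => dist z τ + M * dist z 0 :=
    (convexOn_dist τ convex_univ).add ((convexOn_dist 0 convex_univ).smul hM.le)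
  have h2 : stolzRegion τ M = disk ∩ {z | z ∈ univ ∧ dist z τ + M * dist z 0 < M} := by
    ext z
    simp only [stolzRegion, mem_inter_iff, mem_ofPred_eq, mem_univ, true_and, dist_eq_norm,
      norm_sub_rev z τ, sub_zero]
    refine and_congr_right fun _ => ⟨fun h => by linarith, fun h => by linarith⟩
  rw [h2]
  exact (convex_ball 0 1).inter (h1.convex_lt M)

/-- If an orbit visits a Stolz region at a boundary limit point infinitely often and `f'` tends to
`1` in that region, then the steps of the orbit shrink to zero. -/
lemma tendsto_step_of_frequently_stolz (hf : IsHolSelfMap f) {τ : ℂ} {M : ℝ} (hM : 0 < M)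
    (hderiv : Tendsto (deriv f) (𝓝[stolzRegion τ M] τ) (𝓝 1))
    {z₀ : ℂ} (hz₀ : z₀ ∈ disk) (horb : Tendsto (fun n => f^[n] z₀) atTop (𝓝 τ))
    (hfreq : ∃ᶠ n in atTop, f^[n] z₀ ∈ stolzRegion τ M) :
    Tendsto (fun n => pdist (f^[n] (f z₀)) (f^[n] z₀)) atTop (𝓝 0) := by
  have hanti := hf.antitone_pdist_iterate (hf.mapsTo hz₀) hz₀
  -- By monotonicity one small step suffices.
  suffices h : ∀ ε > 0, ∃ n, pdist (f^[n] (f z₀)) (f^[n] z₀) ≤ ε * M by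
    rw [Metric.tendsto_atTop]
    intro ε hε
    obtain ⟨N, hN⟩ := h (ε / (2 * M)) (by positivity)
    refine ⟨N, fun n hn => ?_⟩
    rw [Real.dist_0_eq_abs, abs_of_nonneg (pdist_nonneg _ _)]
    have h1 : ε / (2 * M) * M = ε / 2 := by field_simp
    have h2 : pdist (f^[n] (f z₀)) (f^[n] z₀) ≤ pdist (f^[N] (f z₀)) (f^[N] z₀) := hanti hn
    linarith
  intro ε hε
  obtain ⟨δ, hδ, hball⟩ := Metric.mem_nhdsWithin_iff.mp
    (hderiv.eventually (Metric.closedBall_mem_nhds (1 : ℂ) hε))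
  set S := ball τ δ ∩ stolzRegion τ M
  have hSc : Convex ℝ S := (convex_ball τ δ).inter (convex_stolzRegion τ hM)
  have hdiff : ∀ x ∈ S, DifferentiableAt ℂ f x := fun x hx =>
    (hf.differentiableOn x hx.2.1).differentiableAt (isOpen_ball.mem_nhds hx.2.1)
  have hlip : ∀ x ∈ S, ∀ y ∈ S, ‖(f y - y) - (f x - x)‖ ≤ ε * ‖y - x‖ := by
    intro x hx y hy
    refine hSc.norm_image_sub_le_of_norm_deriv_le (𝕜 := ℂ) (f := fun z => f z - z)
      (fun z hz => (hdiff z hz).sub differentiableAt_fun_id) (fun z hz => ?_) hx hy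
    have h1 : deriv (fun z => f z - z) z = deriv f z - 1 := by
      rw [deriv_fun_sub (hdiff z hz) differentiableAt_fun_id, deriv_id'']
    rw [h1, ← dist_eq_norm]
    exact hball hz
  have hfreqS : ∃ᶠ n in atTop, f^[n] z₀ ∈ S :=
    (hfreq.and_eventually (horb.eventually (ball_mem_nhds τ hδ))).mono fun n h => ⟨h.2, h.1⟩
  have horb' : Tendsto (fun n => f (f^[n] z₀)) atTop (𝓝 τ) := by
    simpa only [← Function.iterate_succ_apply'] using (tendsto_add_atTop_iff_nat 1).mpr horb
  obtain ⟨n, hn⟩ := hfreqS.exists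
  refine ⟨n, ?_⟩
  -- Here n is fixed and m → ∞ along the visits to S, so that τ plays the role of a boundary fixed
  -- point.
  have hlim : ‖(f (f^[n] z₀) - f^[n] z₀) - (τ - τ)‖ ≤ ε * ‖f^[n] z₀ - τ‖ :=
    le_of_tendsto_of_tendsto_of_frequently
      ((tendsto_const_nhds.sub (horb'.sub horb)).norm)
      ((tendsto_const_nhds.sub horb).norm.const_mul ε)
      (hfreqS.mono fun m hm => hlip _ hm _ hn)
  have hmem := (hf.iterate n).mapsTo hz₀
  rw [← Function.iterate_succ_apply, Function.iterate_succ_apply']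
  refine pdist_le_of_norm_sub_le (hf.mapsTo hmem) hmem ?_
  have h3 := hn.2.2
  rw [norm_sub_rev] at h3
  rw [sub_self, sub_zero] at hlim
  calc _ ≤ ε * ‖f^[n] z₀ - τ‖ := hlim
    _ ≤ ε * (M * (1 - ‖f^[n] z₀‖)) := by gcongr
    _ = _ := by ring

end Dynamics

/-! ### The ratio estimate and the conclusion. -/

lemma norm_div_sub_one_le {τ u z : ℂ} (hτ : ‖τ‖ = 1) (hu : u ∈ disk) (hz : z ∈ disk) :
    ‖(u - τ) / (z - τ) - 1‖ ≤
      pdist u z / (1 - pdist u z) * (2 * ((1 - ‖z‖) / ‖z - τ‖)) := by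
  have hp1 := pdist_lt_one hu hz
  have hp0 := pdist_nonneg u z
  have h := norm_sub_le_of_pdist hu hz
  rw [mem_disk] at hz
  have hne : z - τ ≠ 0 := fun h => by
    rw [sub_eq_zero.mp h] at hz; linarith
  have h0 := norm_pos_iff.mpr hne
  have e : (u - τ) / (z - τ) - 1 = (u - z) / (z - τ) := by field_simp; ring
  rw [e, norm_div, div_le_iff₀ h0]
  have h1 : 1 - ‖z‖ ^ 2 ≤ 2 * (1 - ‖z‖) := by nlinarith [norm_nonneg z]
  calc _ ≤ pdist u z / (1 - pdist u z) * (2 * (1 - ‖z‖)) := by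
        refine h.trans ?_
        have : 0 ≤ pdist u z / (1 - pdist u z) := div_nonneg hp0 (by linarith)
        gcongr
    _ = _ := by field_simp

lemma one_sub_norm_div_le_one {τ z : ℂ} (hτ : ‖τ‖ = 1) :
    (1 - ‖z‖) / ‖z - τ‖ ≤ 1 := by
  refine div_le_one_of_le₀ ?_ (norm_nonneg _)
  have := norm_sub_norm_le τ z
  rwa [hτ, norm_sub_rev] at this

end ParabolicDisk

open ParabolicDisk in
theorem mainTheorem5 (f : ℂ → ℂ) (τ : ℂ) (hf : ParabolicDisk.IsParabolic f τ)
    (z₀ : ℂ) (hz₀ : z₀ ∈ ParabolicDisk.disk) :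
    ParabolicDisk.TendstoOnCompacts
      (fun n z => (f^[n] z - τ) / (f^[n] z₀ - τ)) (fun _ => 1) := by
  intro K hK hKc
  have hh := hf.isHolSelfMap
  have hτ : ‖τ‖ = 1 := by simpa using hf.isWolffPoint.mem_sphere
  have horb : Tendsto (fun n => f^[n] z₀) atTop (𝓝 τ) :=
    (hf.isWolffPoint.tendsto_iterate {z₀} (singleton_subset_iff.mpr hz₀)
      isCompact_singleton).tendsto_at (mem_singleton z₀)
  obtain ⟨r, hr0, hr1, hr⟩ : ∃ r, 0 ≤ r ∧ r < 1 ∧ ∀ z ∈ K, ∀ n,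
      pdist (f^[n] z) (f^[n] z₀) ≤ r := by
    rcases K.eq_empty_or_nonempty with rfl | hne
    · exact ⟨0, le_rfl, one_pos, by simp⟩
    obtain ⟨x, hx, hmax⟩ := hKc.exists_isMaxOn hne ((continuousOn_pdist hz₀).mono hK)
    exact ⟨pdist x z₀, pdist_nonneg _ _, pdist_lt_one (hK hx) hz₀, fun z hz n =>
      ((hh.iterate n).pdist_le (hK hz) hz₀).trans (hmax hz)⟩
  have hbound : ∀ z ∈ K, ∀ n, ‖(f^[n] z - τ) / (f^[n] z₀ - τ) - 1‖ ≤
      pdist (f^[n] z) (f^[n] z₀) / (1 - r) * (2 * ((1 - ‖f^[n] z₀‖) / ‖f^[n] z₀ - τ‖)) := by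
    intro z hz n
    have hmem := (hh.iterate n).mapsTo hz₀
    have h1 := mem_disk.mp hmem
    refine (norm_div_sub_one_le hτ ((hh.iterate n).mapsTo (hK hz)) hmem).trans ?_
    have h2 := hr z hz n
    have : 0 ≤ (1 - ‖f^[n] z₀‖) / ‖f^[n] z₀ - τ‖ := div_nonneg (by linarith) (norm_nonneg _)
    have := pdist_nonneg (f^[n] z) (f^[n] z₀)
    have : 0 < 1 - r := by linarith
    gcongr
  rw [Metric.tendstoUniformlyOn_iff]
  intro ε hε
  -- Dichotomy: tangential orbit, or infinitely many visits to one Stolz region.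
  by_cases htan : Tendsto (fun n => (1 - ‖f^[n] z₀‖) / ‖f^[n] z₀ - τ‖) atTop (𝓝 0)
  · have h1 : Tendsto (fun n => r / (1 - r) * (2 * ((1 - ‖f^[n] z₀‖) / ‖f^[n] z₀ - τ‖)))
        atTop (𝓝 0) := by simpa using (htan.const_mul 2).const_mul (r / (1 - r))
    filter_upwards [h1.eventually_lt_const hε] with n hn z hz
    rw [dist_comm, dist_eq_norm]
    refine ((hbound z hz n).trans ?_).trans_lt hn
    have h2 := mem_disk.mp ((hh.iterate n).mapsTo hz₀)
    have : 0 ≤ (1 - ‖f^[n] z₀‖) / ‖f^[n] z₀ - τ‖ := div_nonneg (by linarith) (norm_nonneg _)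
    have : 0 < 1 - r := by linarith
    have := hr z hz n
    gcongr
  · obtain ⟨M, hM, hfreq⟩ : ∃ M : ℝ, 1 < M ∧ ∃ᶠ n in atTop, f^[n] z₀ ∈ stolzRegion τ M := by
      by_contra! hno
      refine htan (Metric.tendsto_nhds.mpr fun δ hδ => ?_)
      -- The 2 ensures M > 1; the 2/δ bounds the quotient by δ/2, hence strictly below δ.
      have h1 := hno (max 2 (2 / δ)) (lt_max_of_lt_left one_lt_two)
      filter_upwards [h1] with n hn
      have hmem := (hh.iterate n).mapsTo hz₀
      have h2 := mem_disk.mp hmem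
      have h3 : max 2 (2 / δ) * (1 - ‖f^[n] z₀‖) ≤ ‖τ - f^[n] z₀‖ :=
        not_lt.mp fun h => hn ⟨hmem, h⟩
      rw [norm_sub_rev] at h3
      have h4 : 2 / δ * (1 - ‖f^[n] z₀‖) ≤ ‖f^[n] z₀ - τ‖ :=
        le_trans (by gcongr; exact le_max_right _ _) h3
      have h5 : 0 < ‖f^[n] z₀ - τ‖ := lt_of_lt_of_le (by have := sub_pos.mpr h2; positivity) h4
      rw [Real.dist_0_eq_abs, abs_of_nonneg (div_nonneg (by linarith) h5.le), div_lt_iff₀ h5]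
      have h6 : δ * (2 / δ * (1 - ‖f^[n] z₀‖)) = 2 * (1 - ‖f^[n] z₀‖) := by field_simp
      have h7 := mul_le_mul_of_nonneg_left h4 hδ.le
      linarith
    have hstep := tendsto_step_of_frequently_stolz hh (by linarith) (hf.deriv_eq_one M hM) hz₀
      horb hfreq
    have hunif := Metric.tendstoUniformlyOn_iff.mp (tendstoUniformlyOn_pdist_iterate hh
      hf.isWolffPoint.no_fixedPoint hz₀ hstep hK hKc)
    have hr' : 0 < 1 - r := by linarith
    filter_upwards [hunif (ε * (1 - r) / 2) (by positivity)] with n hn z hz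
    have h1 := hn z hz
    rw [dist_comm, Real.dist_0_eq_abs, abs_of_nonneg (pdist_nonneg _ _)] at h1
    rw [dist_comm, dist_eq_norm]
    have h2 := one_sub_norm_div_le_one (z := f^[n] z₀) hτ
    have := pdist_nonneg (f^[n] z) (f^[n] z₀)
    calc _ ≤ _ := hbound z hz n
      _ ≤ pdist (f^[n] z) (f^[n] z₀) / (1 - r) * (2 * 1) := by gcongr
      _ < ε * (1 - r) / 2 / (1 - r) * (2 * 1) := by gcongr
      _ = ε := by field_simp
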